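/- For every $A>0$ there is a constant $c>0$ (depending only on $A$) such that the following holds for every integer $d\ge 2$ and every real $\kappa$ with $10\le\kappa\le A d^4$. For every step size $h>0$ there is a probability density $e^{-f}$ on $\mathbb{R}^d$, with $f:\mathbb{R}^d\to\mathbb{R}$ twice continuously differentiable and all eigenvalues of $\nabla^2 f(x)$ in $[1,\kappa]$ for every $x\in\mathbb{R}^d$, such that the relaxation time of the Metropolis-adjusted Langevin algorithm (MALA) with step size $h$ and target $d\pi(x)=e^{-f(x)}dx$ is at least $c\,\frac{\kappa d}{\log d}$. Here MALA is the Markov chain which from $x$ proposes $y\sim\mathcal{N}(x-h\nabla f(x),\,2h\mathbf{I})$, moves to $y$ with probability $$\min\left(1,\ \frac{\exp\left(-f(y)-\frac{1}{4h}\|x-(y-h\nabla f(y))\|_2^2\right)}{\exp\left(-f(x)-\frac{1}{4h}\|y-(x-h\nabla f(x))\|_2^2\right)}\right),$$ and otherwise stays at $x$. Writing $T_x$ for its transition distribution, its relaxation time is $1/\lambda\in(0,\infty]$ (infinite if $\lambda=0$), where $$\lambda=\inf_g \frac{\mathcal{E}(g,g)}{\mathrm{Var}_\pi[g]},\qquad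 \mathcal{E}(g,g)=\int g^2\,d\pi-\int\!\!\int g(x)g(y)\,T_x(dy)\,\pi(dx),$$ the infimum being over $g\in L^2(\pi)$ with $\mathrm{Var}_\pi[g]>0$. -/

import Mathlib

open MeasureTheory ProbabilityTheory
open scoped ENNReal Gradient

noncomputable section

namespace MALA

/-- Every eigenvalue of the Hessian of `f` lies in `[m, L]` at every point, i.e. `f` is twice
(continuously) differentiable and `m I ≼ ∇² f(x) ≼ L I` for all `x` in the Loewner order. -/
def HessianIn {d : ℕ} (m L : ℝ) (f : EuclideanSpace ℝ (Fin d) → ℝ) : Prop :=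
  ContDiff ℝ 2 f ∧
    ∀ x v : EuclideanSpace ℝ (Fin d),
      m * ‖v‖ ^ 2 ≤ iteratedFDeriv ℝ 2 f x ![v, v] ∧
        iteratedFDeriv ℝ 2 f x ![v, v] ≤ L * ‖v‖ ^ 2

/-- The measure on `ℝ^d` with Lebesgue density `exp (-f)`. -/
def target {d : ℕ} (f : EuclideanSpace ℝ (Fin d) → ℝ) : Measure (EuclideanSpace ℝ (Fin d)) :=
  volume.withDensity fun x => ENNReal.ofReal (Real.exp (-f x))

/-- The Langevin proposal `𝒩(x - h ∇f(x), 2h I)`: the law of `x - h ∇f(x) + √(2h) g` with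
`g ∼ 𝒩(0, I)`. -/
def proposal {d : ℕ} (f : EuclideanSpace ℝ (Fin d) → ℝ) (h : ℝ) (x : EuclideanSpace ℝ (Fin d)) :
    Measure (EuclideanSpace ℝ (Fin d)) :=
  (stdGaussian (EuclideanSpace ℝ (Fin d))).map
    fun g => x - h • ∇ f x + Real.sqrt (2 * h) • g

/-- The Metropolis acceptance probability of a move from `x` to `y`. -/
def accept {d : ℕ} (f : EuclideanSpace ℝ (Fin d) → ℝ) (h : ℝ)
    (x y : EuclideanSpace ℝ (Fin d)) : ℝ :=
  min 1
    (Real.exp (-f y - ‖x - (y - h • ∇ f y)‖ ^ 2 / (4 * h)) /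
      Real.exp (-f x - ‖y - (x - h • ∇ f x)‖ ^ 2 / (4 * h)))

/-- The MALA transition distribution from `x`: accepted proposals move to `y`, and with the
remaining probability the chain stays at `x`. -/
def transition {d : ℕ} (f : EuclideanSpace ℝ (Fin d) → ℝ) (h : ℝ)
    (x : EuclideanSpace ℝ (Fin d)) : Measure (EuclideanSpace ℝ (Fin d)) :=
  (proposal f h x).withDensity (fun y => ENNReal.ofReal (accept f h x y)) +
    (1 - ∫⁻ y, ENNReal.ofReal (accept f h x y) ∂(proposal f h x)) • Measure.dirac x

/-- The Dirichlet form `ℰ(g, k) = ∫ g k dπ - ∬ g(y) k(x) T_x(dy) π(dx)` of a Markov chain with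
transition distributions `T` and stationary distribution `π`. -/
def dirichletForm {α : Type*} [MeasurableSpace α] (T : α → Measure α) (π : Measure α)
    (g k : α → ℝ) : ℝ :=
  ∫ x, g x * k x ∂π - ∫ x, (∫ y, g y ∂(T x)) * k x ∂π

/-- The spectral gap `inf_g ℰ(g, g) / Var_π[g]`, over square-integrable `g` of nonzero variance.
For a reversible chain all these ratios are nonnegative, so nothing is lost in `ℝ≥0∞`. -/
def spectralGap {α : Type*} [MeasurableSpace α] (T : α → Measure α) (π : Measure α) : ℝ≥0∞ :=
  ⨅ (g : α → ℝ) (_ : MemLp g 2 π) (_ : variance g π ≠ 0),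
    ENNReal.ofReal (dirichletForm T π g g / variance g π)

/-- The relaxation time: the inverse of the spectral gap (infinite when the gap is zero). -/
def relaxationTime {α : Type*} [MeasurableSpace α] (T : α → Measure α) (π : Measure α) : ℝ≥0∞ :=
  (spectralGap T π)⁻¹

end MALA

end

open MeasureTheory ProbabilityTheory
open scoped ENNReal Gradient

noncomputable section

namespace MALA

/-! The target may depend on `h`, so three separable targets suffice, one for each range of step
sizes. Put τ = log d / (κ d); the aim is a spectral gap of O(τ).

Small steps, `h` ≲ τ: for the standard Gaussian a coordinate moves by a drift of order `h`, and
using it as test function gives gap ≤ `h + h ^ 2 * |1 - h|` (`spectralGap_gaussPotential_le`).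

Larger steps: a single point with acceptance rate below ε already forces gap ≤ 2ε. By continuity the
rate stays below ε on a small ball, whose indicator is the test function; the mass of the ball is
irrelevant (`spectralGap_le_of_acceptRate_lt`). At the mode of a separable potential the Metropolis
ratio is a product over coordinates, so the acceptance rate is at most the d-th power of a
one-dimensional Gaussian integral (`acceptRate_sepPotential_zero_le`). For τ ≲ `h` ≲ 1/κ, a cosine
of wavelength comparable to √h is added to a quadratic. The quadratic cancels from the log ratio up
to a nonpositive term, and the cosine leaves a variable of mean (κh/3)(2/e - 1) < 0. The integral is
then at most exp(-δκh/3), with d-th power at most d⁻⁵. For `h` ≳ 1/κ, the quadratic of curvature κ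
makes the integral at most a constant below 1, and its d-th power is again O(d⁻⁵). Finally κ ≤ A d⁴
turns d⁻⁵ into O(τ). -/

/-! ### Separable potentials -/

/-- The potential `x ↦ ∑ i, φ (x i)` on `ℝ^d`. -/
def sepPotential (d : ℕ) (φ : ℝ → ℝ) : EuclideanSpace ℝ (Fin d) → ℝ := fun x => ∑ i, φ (x i)

section Separable

variable {d : ℕ} {φ φ' φ'' : ℝ → ℝ}

theorem hasFDerivAt_sepPotential (hφ : ∀ t, HasDerivAt φ (φ' t) t)
    (x : EuclideanSpace ℝ (Fin d)) :
    HasFDerivAt (sepPotential d φ)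
      (∑ i, φ' (x i) • (EuclideanSpace.proj i : EuclideanSpace ℝ (Fin d) →L[ℝ] ℝ)) x := by
  unfold sepPotential
  refine HasFDerivAt.fun_sum fun i _ => ?_
  exact (hφ (x i)).comp_hasFDerivAt x
    (EuclideanSpace.proj i : EuclideanSpace ℝ (Fin d) →L[ℝ] ℝ).hasFDerivAt

theorem gradient_sepPotential (hφ : ∀ t, HasDerivAt φ (φ' t) t)
    (x : EuclideanSpace ℝ (Fin d)) :
    ∇ (sepPotential d φ) x = WithLp.toLp 2 fun i => φ' (x i) := by
  refine HasGradientAt.gradient ?_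
  rw [hasGradientAt_iff_hasFDerivAt]
  have hdual : InnerProductSpace.toDual ℝ (EuclideanSpace ℝ (Fin d))
      (WithLp.toLp 2 fun i => φ' (x i)) =
      ∑ i, φ' (x i) • (EuclideanSpace.proj i : EuclideanSpace ℝ (Fin d) →L[ℝ] ℝ) := by
    ext v
    simp [PiLp.inner_apply, mul_comm]
  rw [hdual]
  exact hasFDerivAt_sepPotential hφ x

theorem hessianIn_sepPotential {m L : ℝ} (hc : ContDiff ℝ 2 φ)
    (hφ : ∀ t, HasDerivAt φ (φ' t) t) (hφ' : ∀ t, HasDerivAt φ' (φ'' t) t)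
    (hm : ∀ t, m ≤ φ'' t) (hL : ∀ t, φ'' t ≤ L) : HessianIn m L (sepPotential d φ) := by
  refine ⟨ContDiff.sum fun i _ => hc.comp
    (EuclideanSpace.proj i : EuclideanSpace ℝ (Fin d) →L[ℝ] ℝ).contDiff, fun x v => ?_⟩
  have h1 : fderiv ℝ (sepPotential d φ) = fun x : EuclideanSpace ℝ (Fin d) =>
      ∑ i, φ' (x i) • (EuclideanSpace.proj i : EuclideanSpace ℝ (Fin d) →L[ℝ] ℝ) :=
    funext fun x => (hasFDerivAt_sepPotential hφ x).fderiv
  have h2 : HasFDerivAt (fderiv ℝ (sepPotential d φ))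
      (∑ i, (φ'' (x i) • (EuclideanSpace.proj i : EuclideanSpace ℝ (Fin d) →L[ℝ] ℝ)).smulRight
        (EuclideanSpace.proj i : EuclideanSpace ℝ (Fin d) →L[ℝ] ℝ)) x := by
    rw [h1]
    refine HasFDerivAt.fun_sum fun i _ => ?_
    exact HasFDerivAt.smul_const (𝕜' := ℝ) ((hφ' (x i)).comp_hasFDerivAt x
      (EuclideanSpace.proj i : EuclideanSpace ℝ (Fin d) →L[ℝ] ℝ).hasFDerivAt)
      (EuclideanSpace.proj i : EuclideanSpace ℝ (Fin d) →L[ℝ] ℝ)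
  have h3 : iteratedFDeriv ℝ 2 (sepPotential d φ) x ![v, v] = ∑ i, φ'' (x i) * (v i) ^ 2 := by
    rw [iteratedFDeriv_two_apply, h2.fderiv]
    simp only [sum_apply, ContinuousLinearMap.smulRight_apply]
    refine Finset.sum_congr rfl fun i _ => ?_
    simp
    ring
  rw [h3, EuclideanSpace.real_norm_sq_eq, Finset.mul_sum, Finset.mul_sum]
  exact ⟨Finset.sum_le_sum fun i _ => mul_le_mul_of_nonneg_right (hm _) (sq_nonneg _),
    Finset.sum_le_sum fun i _ => mul_le_mul_of_nonneg_right (hL _) (sq_nonneg _)⟩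

theorem pi_withDensity_eq (hφ : Continuous φ)
    [IsProbabilityMeasure ((volume : Measure ℝ).withDensity
      fun t => ENNReal.ofReal (Real.exp (-φ t)))] :
    (volume : Measure (Fin d → ℝ)).withDensity
        (fun x => ENNReal.ofReal (Real.exp (-∑ i, φ (x i)))) =
      Measure.pi fun _ : Fin d => (volume : Measure ℝ).withDensity
        fun t => ENNReal.ofReal (Real.exp (-φ t)) := by
  have hfin : ∫⁻ t, ENNReal.ofReal (Real.exp (-φ t)) = 1 := by
    rw [← setLIntegral_univ, ← withDensity_apply _ MeasurableSet.univ, measure_univ]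
  have hint : Integrable fun t => Real.exp (-φ t) := by
    refine ⟨(by fun_prop : Continuous fun t => Real.exp (-φ t)).aestronglyMeasurable, ?_⟩
    rw [hasFiniteIntegral_iff_ofReal (Filter.Eventually.of_forall fun _ => (Real.exp_pos _).le),
      hfin]
    exact ENNReal.one_lt_top
  symm
  refine Measure.pi_eq fun s hs => ?_
  rw [withDensity_apply _ (MeasurableSet.univ_pi hs), volume_pi, Measure.restrict_pi_pi]
  have hexp : ∀ x : Fin d → ℝ, Real.exp (-∑ i, φ (x i)) = ∏ i, Real.exp (-φ (x i)) := fun x => by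
    rw [← Real.exp_sum, Finset.sum_neg_distrib]
  simp_rw [hexp]
  rw [← ofReal_integral_eq_lintegral_ofReal
    (Integrable.fintype_prod fun i => hint.integrableOn)
    (Filter.Eventually.of_forall fun x => Finset.prod_nonneg fun i _ => (Real.exp_pos _).le),
    integral_fintype_prod_eq_prod (fun (i : Fin d) t => Real.exp (-φ t)),
    ENNReal.ofReal_prod_of_nonneg fun i _ => integral_nonneg fun _ => (Real.exp_pos _).le]
  refine Finset.prod_congr rfl fun i _ => ?_
  rw [withDensity_apply _ (hs i), ofReal_integral_eq_lintegral_ofReal hint.integrableOn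
    (Filter.Eventually.of_forall fun x => (Real.exp_pos _).le)]

theorem target_sepPotential (hφ : Continuous φ)
    [IsProbabilityMeasure ((volume : Measure ℝ).withDensity
      fun t => ENNReal.ofReal (Real.exp (-φ t)))] :
    target (sepPotential d φ) =
      (Measure.pi fun _ : Fin d => (volume : Measure ℝ).withDensity
        fun t => ENNReal.ofReal (Real.exp (-φ t))).map (WithLp.toLp 2) := by
  rw [← pi_withDensity_eq hφ]
  ext s hs
  rw [Measure.map_apply (by fun_prop) hs, target, withDensity_apply _ hs,
    withDensity_apply _ ((by fun_prop : Measurable (WithLp.toLp 2 : (Fin d → ℝ) → _)) hs),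
    ← (PiLp.volume_preserving_toLp (Fin d)).setLIntegral_comp_preimage hs]
  · rfl
  · have : Continuous (sepPotential d φ) := by unfold sepPotential; fun_prop
    fun_prop

theorem isProbabilityMeasure_target_sepPotential (hφ : Continuous φ)
    [IsProbabilityMeasure ((volume : Measure ℝ).withDensity
      fun t => ENNReal.ofReal (Real.exp (-φ t)))] :
    IsProbabilityMeasure (target (sepPotential d φ)) := by
  rw [target_sepPotential hφ]
  exact Measure.isProbabilityMeasure_map (by fun_prop)

end Separable

/-- A continuous potential with a quadratic lower bound can be normalised by a constant. -/
theorem exists_add_const_isProbabilityMeasure {φ : ℝ → ℝ} (hφ : Continuous φ) {a b : ℝ}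
    (ha : 0 < a) (hb : ∀ t, a * t ^ 2 - b ≤ φ t) :
    ∃ c : ℝ, IsProbabilityMeasure ((volume : Measure ℝ).withDensity
      fun t => ENNReal.ofReal (Real.exp (-(φ t + c)))) := by
  have hint : Integrable fun t => Real.exp (-φ t) := by
    refine ((integrable_exp_neg_mul_sq ha).const_mul (Real.exp b)).mono'
      (by fun_prop : Continuous fun t => Real.exp (-φ t)).aestronglyMeasurable
      (Filter.Eventually.of_forall fun t => ?_)
    rw [Real.norm_eq_abs, abs_of_pos (Real.exp_pos _), ← Real.exp_add]
    exact Real.exp_le_exp.2 (by linarith [hb t])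
  have hpos : 0 < ∫ t, Real.exp (-φ t) := integral_exp_pos hint
  refine ⟨Real.log (∫ t, Real.exp (-φ t)), ⟨?_⟩⟩
  rw [withDensity_apply _ MeasurableSet.univ, setLIntegral_univ]
  have h1 : ∀ t, Real.exp (-(φ t + Real.log (∫ t, Real.exp (-φ t)))) =
      Real.exp (-φ t) / ∫ t, Real.exp (-φ t) := fun t => by
    rw [neg_add, ← sub_eq_add_neg, Real.exp_sub, Real.exp_log hpos]
  simp_rw [h1]
  rw [← ofReal_integral_eq_lintegral_ofReal (hint.div_const _)
    (Filter.Eventually.of_forall fun t => by positivity), integral_div, div_self hpos.ne',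
    ENNReal.ofReal_one]

/-! ### Bounding the spectral gap through the acceptance probability -/

section General

variable {d : ℕ} {f : EuclideanSpace ℝ (Fin d) → ℝ} {h : ℝ}

/-- The proposed state from `x` when the Gaussian noise is `z`. -/
def move (f : EuclideanSpace ℝ (Fin d) → ℝ) (h : ℝ) (x z : EuclideanSpace ℝ (Fin d)) :
    EuclideanSpace ℝ (Fin d) :=
  x - h • ∇ f x + Real.sqrt (2 * h) • z

/-- The acceptance probability from `x`, averaged over the proposal. -/
def acceptRate (f : EuclideanSpace ℝ (Fin d) → ℝ) (h : ℝ) (x : EuclideanSpace ℝ (Fin d)) : ℝ :=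
  ∫ z, accept f h x (move f h x z) ∂stdGaussian (EuclideanSpace ℝ (Fin d))

theorem accept_nonneg (x y : EuclideanSpace ℝ (Fin d)) : 0 ≤ accept f h x y :=
  le_min zero_le_one (by positivity)

theorem accept_le_one (x y : EuclideanSpace ℝ (Fin d)) : accept f h x y ≤ 1 := min_le_left _ _

theorem norm_accept_le_one (x y : EuclideanSpace ℝ (Fin d)) : ‖accept f h x y‖ ≤ 1 := by
  rw [Real.norm_eq_abs, abs_of_nonneg (accept_nonneg _ _)]
  exact accept_le_one _ _

theorem continuous_accept (hf : Continuous f) (hf' : Continuous (∇ f)) :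
    Continuous fun p : EuclideanSpace ℝ (Fin d) × EuclideanSpace ℝ (Fin d) =>
      accept f h p.1 p.2 := by
  unfold accept
  have hne : ∀ p : EuclideanSpace ℝ (Fin d) × EuclideanSpace ℝ (Fin d),
      Real.exp (-f p.1 - ‖p.2 - (p.1 - h • ∇ f p.1)‖ ^ 2 / (4 * h)) ≠ 0 :=
    fun p => (Real.exp_pos _).ne'
  fun_prop (disch := exact hne)

theorem continuous_move (hf' : Continuous (∇ f)) :
    Continuous fun p : EuclideanSpace ℝ (Fin d) × EuclideanSpace ℝ (Fin d) =>
      move f h p.1 p.2 := by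
  unfold move
  fun_prop

theorem continuous_accept_move (hf : Continuous f) (hf' : Continuous (∇ f)) :
    Continuous fun p : EuclideanSpace ℝ (Fin d) × EuclideanSpace ℝ (Fin d) =>
      accept f h p.1 (move f h p.1 p.2) :=
  (continuous_accept hf hf').comp (continuous_fst.prodMk (continuous_move hf'))

theorem integrable_accept_move (hf : Continuous f) (hf' : Continuous (∇ f))
    (x : EuclideanSpace ℝ (Fin d)) :
    Integrable (fun z => accept f h x (move f h x z))
      (stdGaussian (EuclideanSpace ℝ (Fin d))) :=
  Integrable.of_bound
    ((continuous_accept_move hf hf').comp (Continuous.prodMk_right x)).aestronglyMeasurable 1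
    (Filter.Eventually.of_forall fun _ => norm_accept_le_one _ _)

theorem acceptRate_nonneg (x : EuclideanSpace ℝ (Fin d)) : 0 ≤ acceptRate f h x :=
  integral_nonneg fun _ => accept_nonneg _ _

theorem acceptRate_le_one (x : EuclideanSpace ℝ (Fin d)) : acceptRate f h x ≤ 1 := by
  refine (integral_mono_of_nonneg (Filter.Eventually.of_forall fun _ => accept_nonneg _ _)
    (integrable_const 1) (Filter.Eventually.of_forall fun _ => accept_le_one _ _)).trans ?_
  simp

theorem continuous_accept_move_left (hf : Continuous f) (hf' : Continuous (∇ f))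
    (z : EuclideanSpace ℝ (Fin d)) :
    Continuous fun x => accept f h x (move f h x z) := by
  have hz : Continuous fun x : EuclideanSpace ℝ (Fin d) => (x, z) := by fun_prop
  have hcomp := (continuous_accept_move (h := h) hf hf').comp hz
  simpa only [Function.comp_def] using hcomp

theorem continuous_acceptRate (hf : Continuous f) (hf' : Continuous (∇ f)) :
    Continuous (acceptRate f h) := by
  unfold acceptRate
  apply continuous_of_dominated (bound := fun _ => 1)
  · exact fun x => (integrable_accept_move hf hf' x).aestronglyMeasurable
  · exact fun x => Filter.Eventually.of_forall fun z => norm_accept_le_one _ _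
  · exact integrable_const 1
  · exact Filter.Eventually.of_forall (continuous_accept_move_left hf hf')

theorem proposal_eq_map_move (x : EuclideanSpace ℝ (Fin d)) :
    proposal f h x = (stdGaussian (EuclideanSpace ℝ (Fin d))).map (move f h x) := rfl

theorem lintegral_accept_proposal (hf : Continuous f) (hf' : Continuous (∇ f))
    (x : EuclideanSpace ℝ (Fin d)) :
    ∫⁻ y, ENNReal.ofReal (accept f h x y) ∂(proposal f h x) =
      ENNReal.ofReal (acceptRate f h x) := by
  have hm : Measurable fun y => accept f h x y :=
    ((continuous_accept hf hf').comp (Continuous.prodMk_right x)).measurable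
  have hmove : Measurable (move f h x) :=
    ((continuous_move hf').comp (Continuous.prodMk_right x)).measurable
  rw [proposal_eq_map_move, lintegral_map hm.ennreal_ofReal hmove, acceptRate,
    ofReal_integral_eq_lintegral_ofReal (integrable_accept_move hf hf' x)
      (Filter.Eventually.of_forall fun _ => accept_nonneg _ _)]

theorem integrable_accept_mul (hf : Continuous f) (hf' : Continuous (∇ f))
    {g : EuclideanSpace ℝ (Fin d) → ℝ} {x : EuclideanSpace ℝ (Fin d)}
    (hint : Integrable (fun z => g (move f h x z)) (stdGaussian (EuclideanSpace ℝ (Fin d)))) :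
    Integrable (fun z => accept f h x (move f h x z) * g (move f h x z))
      (stdGaussian (EuclideanSpace ℝ (Fin d))) :=
  hint.bdd_mul (c := 1) (integrable_accept_move hf hf' x).aestronglyMeasurable
    (Filter.Eventually.of_forall fun _ => norm_accept_le_one _ _)

theorem integral_transition (hf : Continuous f) (hf' : Continuous (∇ f))
    {g : EuclideanSpace ℝ (Fin d) → ℝ} (hg : Measurable g) {x : EuclideanSpace ℝ (Fin d)}
    (hint : Integrable (fun z => g (move f h x z)) (stdGaussian (EuclideanSpace ℝ (Fin d)))) :
    ∫ y, g y ∂(transition f h x) =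
      ∫ z, accept f h x (move f h x z) * g (move f h x z)
          ∂stdGaussian (EuclideanSpace ℝ (Fin d)) +
        (1 - acceptRate f h x) * g x := by
  have hm : Measurable fun y => accept f h x y :=
    ((continuous_accept hf hf').comp (Continuous.prodMk_right x)).measurable
  have hmove : Measurable (move f h x) :=
    ((continuous_move hf').comp (Continuous.prodMk_right x)).measurable
  have hmg : Measurable fun y => accept f h x y * g y := hm.mul hg
  have hscal : (fun y => (ENNReal.ofReal (accept f h x y)).toReal • g y) =
      fun y => accept f h x y * g y := by
    funext y
    rw [ENNReal.toReal_ofReal (accept_nonneg _ _), smul_eq_mul]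
  have hint1 : Integrable g
      ((proposal f h x).withDensity fun y => ENNReal.ofReal (accept f h x y)) := by
    rw [integrable_withDensity_iff_integrable_smul' hm.ennreal_ofReal
      (Filter.Eventually.of_forall fun _ => ENNReal.ofReal_lt_top), hscal, proposal_eq_map_move,
      integrable_map_measure hmg.aestronglyMeasurable hmove.aemeasurable]
    exact integrable_accept_mul hf hf' hint
  have hint2 : Integrable g ((1 - ENNReal.ofReal (acceptRate f h x)) • Measure.dirac x) :=
    (integrable_dirac (by simp)).smul_measure (ENNReal.sub_ne_top ENNReal.one_ne_top)
  rw [transition, lintegral_accept_proposal hf hf', integral_add_measure hint1 hint2,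
    integral_withDensity_eq_integral_toReal_smul hm.ennreal_ofReal
      (Filter.Eventually.of_forall fun _ => ENNReal.ofReal_lt_top), hscal, proposal_eq_map_move,
    integral_map hmove.aemeasurable hmg.aestronglyMeasurable, integral_smul_measure,
    integral_dirac, ENNReal.toReal_sub_of_le (by
      rw [← ENNReal.ofReal_one]
      exact ENNReal.ofReal_le_ofReal (acceptRate_le_one x)) ENNReal.one_ne_top,
    ENNReal.toReal_ofReal (acceptRate_nonneg x), ENNReal.toReal_one, smul_eq_mul]

/-- A pointwise drift bound controls the Dirichlet form. -/
theorem dirichletForm_le (hf : Continuous f) (hf' : Continuous (∇ f))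
    {g : EuclideanSpace ℝ (Fin d) → ℝ} (hg : Measurable g) (hL2 : MemLp g 2 (target f))
    (hint : ∀ x, Integrable (fun z => g (move f h x z))
      (stdGaussian (EuclideanSpace ℝ (Fin d)))) {C : ℝ}
    (hC : ∀ x, |(∫ z, accept f h x (move f h x z) * (g x - g (move f h x z))
      ∂stdGaussian (EuclideanSpace ℝ (Fin d))) * g x| ≤ C * g x ^ 2) :
    dirichletForm (transition f h) (target f) g g ≤ C * ∫ x, g x ^ 2 ∂target f := by
  set D : EuclideanSpace ℝ (Fin d) → ℝ := fun x =>
    ∫ z, accept f h x (move f h x z) * (g x - g (move f h x z))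
      ∂stdGaussian (EuclideanSpace ℝ (Fin d)) with hD
  have hDm : StronglyMeasurable D := by
    refine StronglyMeasurable.integral_prod_right'
      (f := fun p : EuclideanSpace ℝ (Fin d) × EuclideanSpace ℝ (Fin d) =>
        accept f h p.1 (move f h p.1 p.2) * (g p.1 - g (move f h p.1 p.2))) ?_
    exact ((continuous_accept_move hf hf').measurable.mul ((hg.comp measurable_fst).sub
      (hg.comp (continuous_move hf').measurable))).stronglyMeasurable
  have hsq : Integrable (fun x => g x ^ 2) (target f) := hL2.integrable_sq
  -- Rejected mass stays at `x` and so drops out of `g - Tg`, which leaves exactly `D`.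
  have hT : ∀ x, (∫ y, g y ∂(transition f h x)) * g x = g x ^ 2 - D x * g x := fun x => by
    have hsub : D x = acceptRate f h x * g x -
        ∫ z, accept f h x (move f h x z) * g (move f h x z)
          ∂stdGaussian (EuclideanSpace ℝ (Fin d)) := by
      rw [hD, acceptRate, ← integral_mul_const, ← integral_sub
        ((integrable_accept_move hf hf' x).mul_const _) (integrable_accept_mul hf hf' (hint x))]
      exact integral_congr_ae (Filter.Eventually.of_forall fun z => mul_sub _ _ _)
    rw [integral_transition hf hf' hg (hint x), hsub]
    ring
  have hDint : Integrable (fun x => D x * g x) (target f) :=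
    (hsq.const_mul C).mono' (hDm.aestronglyMeasurable.mul hg.aestronglyMeasurable)
      (Filter.Eventually.of_forall hC)
  unfold dirichletForm
  simp_rw [hT, ← pow_two]
  rw [integral_sub hsq hDint, sub_sub_cancel, ← integral_const_mul]
  exact integral_mono hDint (hsq.const_mul C) fun x => (le_abs_self _).trans (hC x)

theorem spectralGap_le {α : Type*} [MeasurableSpace α] {T : α → Measure α} {π : Measure α}
    {g : α → ℝ} {C : ℝ} (hL2 : MemLp g 2 π) (hV : 0 < variance g π)
    (hE : dirichletForm T π g g ≤ C * variance g π) :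
    spectralGap T π ≤ ENNReal.ofReal C :=
  (iInf_le _ g).trans <| (iInf_le _ hL2).trans <| (iInf_le _ hV.ne').trans <|
    ENNReal.ofReal_le_ofReal ((div_le_iff₀ hV).2 hE)

/-- A state that rejects almost all proposals makes the chain slow. -/
theorem spectralGap_le_of_acceptRate_lt [Nonempty (Fin d)] (hf : Continuous f)
    (hf' : Continuous (∇ f))
    [IsProbabilityMeasure (target f)] {x₀ : EuclideanSpace ℝ (Fin d)} {ε : ℝ}
    (hε : acceptRate f h x₀ < ε) :
    spectralGap (transition f h) (target f) ≤ ENNReal.ofReal (2 * ε) := by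
  have hε0 : 0 < ε := (acceptRate_nonneg x₀).trans_lt hε
  have hac : target f ≪ volume := withDensity_absolutelyContinuous _ _
  have hac' : volume ≪ target f := by
    refine withDensity_absolutelyContinuous' (by fun_prop) ?_
    exact Filter.Eventually.of_forall fun x => (ENNReal.ofReal_pos.2 (Real.exp_pos _)).ne'
  have hx0 : target f {x₀} < 1 / 2 := by
    rw [hac (measure_singleton x₀)]
    simp
  -- Points are null, so outer regularity gives a neighbourhood of mass below 1/2. This keeps the
  -- variance of the indicator comparable to the mass.
  obtain ⟨U, hU0, hUo, hUlt⟩ := Set.exists_isOpen_lt_of_lt {x₀} _ hx0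
  set B : Set (EuclideanSpace ℝ (Fin d)) := U ∩ acceptRate f h ⁻¹' Set.Iio ε with hB
  have hBo : IsOpen B := hUo.inter (isOpen_Iio.preimage (continuous_acceptRate hf hf'))
  have hBm : MeasurableSet B := hBo.measurableSet
  have hBpos : 0 < (target f).real B := by
    refine ENNReal.toReal_pos (fun h0 => ?_) (measure_ne_top _ _)
    exact (hBo.measure_pos volume ⟨x₀, hU0 rfl, hε⟩).ne' (hac' h0)
  have hBhalf : (target f).real B ≤ 1 / 2 := by
    have h1 : target f B ≤ 1 / 2 := (measure_mono Set.inter_subset_left).trans hUlt.le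
    have h2 := ENNReal.toReal_mono (by simp) h1
    simpa [Measure.real] using h2
  set g : EuclideanSpace ℝ (Fin d) → ℝ := B.indicator 1 with hg
  have hgm : Measurable g := measurable_one.indicator hBm
  have hg2 : ∀ x, g x ^ 2 = g x := fun x => by
    by_cases hx : x ∈ B <;> simp [hg, hx]
  have hL2 : MemLp g 2 (target f) := memLp_indicator_const 2 hBm 1 (Or.inr (measure_ne_top _ _))
  have hgi : ∫ x, g x ∂target f = (target f).real B := by
    rw [hg, integral_indicator_one hBm]
  have hvar : variance g (target f) = (target f).real B - (target f).real B ^ 2 := by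
    rw [variance_eq_sub hL2, hgi]
    simp only [Pi.pow_apply, hg2, hgi]
  have hgb : ∀ x, 0 ≤ g x ∧ g x ≤ 1 := fun x => by
    by_cases hx : x ∈ B <;> simp [hg, hx]
  -- Off `B` both sides of the drift bound vanish; on `B` the chance of leaving is at most the
  -- acceptance rate, which is below ε.
  have hD : dirichletForm (transition f h) (target f) g g ≤ ε * (target f).real B := by
    have := dirichletForm_le (h := h) (C := ε) hf hf' hgm hL2 (fun x => ?_) (fun x => ?_)
    · simpa only [hg2, hgi] using this
    · refine Integrable.of_bound (C := 1) (hgm.comp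
        ((continuous_move hf').comp (Continuous.prodMk_right x)).measurable).aestronglyMeasurable
        (Filter.Eventually.of_forall fun z => ?_)
      rw [Real.norm_eq_abs, abs_of_nonneg (hgb _).1]
      exact (hgb _).2
    · by_cases hx : x ∈ B
      · have hgx : g x = 1 := by simp [hg, hx]
        rw [hgx, mul_one, one_pow, mul_one, abs_of_nonneg (integral_nonneg fun z =>
          mul_nonneg (accept_nonneg _ _) (sub_nonneg.2 (hgb _).2))]
        refine (integral_mono_of_nonneg (Filter.Eventually.of_forall fun z =>
          mul_nonneg (accept_nonneg _ _) (sub_nonneg.2 (hgb _).2))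
          (integrable_accept_move hf hf' x) (Filter.Eventually.of_forall fun z => ?_)).trans
          (le_of_lt hx.2)
        exact mul_le_of_le_one_right (accept_nonneg _ _) (by linarith [(hgb (move f h x z)).1])
      · have hgx : g x = 0 := by simp [hg, hx]
        simp [hgx]
  have hvle : (target f).real B ≤ 2 * variance g (target f) := by
    rw [hvar]
    nlinarith
  refine spectralGap_le hL2 (by linarith) (hD.trans ?_)
  nlinarith

end General

/-! ### Acceptance at the mode of a separable potential -/

/-- The logarithm of the Metropolis ratio of a move from `0` to `y`, for the one-dimensional
potential `φ` with a critical point at `0`. -/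
def modeLogRatio (φ φ' : ℝ → ℝ) (h y : ℝ) : ℝ :=
  φ 0 - φ y + y * φ' y / 2 - h * φ' y ^ 2 / 4

/-- The gradient vanishes at 0, so the proposal is a centred Gaussian with independent coordinates.
Bounding the minimum by the ratio itself makes the integrand a product. -/
theorem acceptRate_sepPotential_zero_le {d : ℕ} {φ φ' : ℝ → ℝ} {h : ℝ} (hh : 0 < h)
    (hφ : ∀ t, HasDerivAt φ (φ' t) t) (hφ0 : φ' 0 = 0)
    (hint : Integrable (fun t => Real.exp (modeLogRatio φ φ' h (Real.sqrt (2 * h) * t)))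
      (gaussianReal 0 1)) :
    acceptRate (sepPotential d φ) h 0 ≤
      (∫ t, Real.exp (modeLogRatio φ φ' h (Real.sqrt (2 * h) * t)) ∂gaussianReal 0 1) ^ d := by
  have hgrad0 : ∇ (sepPotential d φ) 0 = 0 := by
    rw [gradient_sepPotential hφ]
    ext i
    simp [hφ0]
  have hmove : ∀ z, move (sepPotential d φ) h 0 z = Real.sqrt (2 * h) • z := fun z => by
    simp [move, hgrad0]
  have hacc : ∀ y, accept (sepPotential d φ) h 0 y ≤ ∏ i, Real.exp (modeLogRatio φ φ' h (y i)) := by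
    intro y
    refine (min_le_right _ _).trans (le_of_eq ?_)
    -- Expanding the squares, the terms `y i ^ 2 / (4 * h)` of the two proposal densities cancel.
    rw [← Real.exp_sub, ← Real.exp_sum, hgrad0, gradient_sepPotential hφ,
      EuclideanSpace.real_norm_sq_eq, EuclideanSpace.real_norm_sq_eq]
    congr 1
    simp only [sepPotential, smul_zero, sub_zero, zero_sub, PiLp.sub_apply, PiLp.neg_apply,
      PiLp.smul_apply, PiLp.zero_apply, smul_eq_mul, Finset.sum_div, ← Finset.sum_neg_distrib,
      ← Finset.sum_sub_distrib]
    refine Finset.sum_congr rfl fun i _ => ?_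
    rw [modeLogRatio]
    field_simp
    ring
  have hprod : Integrable (fun x : Fin d → ℝ =>
      ∏ i, Real.exp (modeLogRatio φ φ' h (Real.sqrt (2 * h) * x i)))
      (Measure.pi fun _ : Fin d => gaussianReal 0 1) :=
    Integrable.fintype_prod fun _ => hint
  unfold acceptRate
  rw [← map_pi_eq_stdGaussian]
  -- Measurability of the integrand is not assumed; when it fails, the acceptance rate is 0 by the
  -- convention for the integral.
  by_cases hm : AEStronglyMeasurable (fun z => accept (sepPotential d φ) h 0
      (move (sepPotential d φ) h 0 z))
      ((Measure.pi fun _ : Fin d => gaussianReal 0 1).map (WithLp.toLp 2))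
  · have hpow := integral_fintype_prod_eq_pow (ι := Fin d) (μ := gaussianReal 0 1)
      fun t => Real.exp (modeLogRatio φ φ' h (Real.sqrt (2 * h) * t))
    rw [Fintype.card_fin] at hpow
    rw [integral_map (by fun_prop) hm, ← hpow]
    refine integral_mono_of_nonneg (Filter.Eventually.of_forall fun _ => accept_nonneg _ _) hprod
      (Filter.Eventually.of_forall fun x => ?_)
    refine (hacc _).trans (le_of_eq ?_)
    simp [hmove]
  · rw [integral_undef fun hi => hm hi.aestronglyMeasurable]
    exact pow_nonneg (integral_nonneg fun _ => (Real.exp_pos _).le) _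

/-! ### Gaussian integrals -/

theorem integral_exp_neg_mul_sq_gaussianReal {a : ℝ} :
    ∫ t, Real.exp (-(a * t ^ 2)) ∂gaussianReal 0 1 =
      (Real.sqrt (2 * Real.pi))⁻¹ * Real.sqrt (Real.pi / (a + 1 / 2)) := by
  rw [integral_gaussianReal_eq_integral_smul one_ne_zero, ← integral_gaussian,
    ← integral_const_mul]
  refine integral_congr_ae (Filter.Eventually.of_forall fun t => ?_)
  simp only [gaussianPDFReal, NNReal.coe_one, mul_one, sub_zero, smul_eq_mul, mul_assoc,
    ← Real.exp_add]
  congr 2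
  ring

theorem integral_exp_neg_mul_sq_gaussianReal_le {a b : ℝ} (hb : 0 < b) (hab : b ≤ a) :
    ∫ t, Real.exp (-(a * t ^ 2)) ∂gaussianReal 0 1 ≤ Real.sqrt (1 / (1 + 2 * b)) := by
  have hpi := Real.pi_pos
  rw [integral_exp_neg_mul_sq_gaussianReal, ← Real.sqrt_inv, ← Real.sqrt_mul (by positivity)]
  refine Real.sqrt_le_sqrt ?_
  have ha : 0 < a + 1 / 2 := by linarith
  rw [inv_mul_eq_div, div_div, div_le_div_iff₀ (by positivity) (by positivity)]
  nlinarith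

/-- The real part of the Gaussian characteristic function. -/
theorem integral_cos_gaussianReal (t : ℝ) :
    ∫ z, Real.cos (t * z) ∂gaussianReal 0 1 = Real.exp (-(t ^ 2 / 2)) := by
  have h1 := congrArg Complex.re (charFun_gaussianReal (μ := 0) (v := 1) t)
  rw [charFun_apply_real] at h1
  have hint : Integrable (fun x : ℝ => Complex.exp (t * x * Complex.I)) (gaussianReal 0 1) := by
    refine Integrable.of_bound (by fun_prop) 1 (Filter.Eventually.of_forall fun x => ?_)
    rw [← Complex.ofReal_mul, Complex.norm_exp_ofReal_mul_I]
  have h2 := integral_re hint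
  simp only [RCLike.re_to_complex] at h2
  rw [← h2] at h1
  simp_rw [← Complex.ofReal_mul, Complex.exp_ofReal_mul_I_re] at h1
  rw [h1]
  convert Complex.exp_ofReal_re _ using 3
  push_cast
  simp

/-- Gaussian integration by parts for the sine. -/
theorem integral_mul_sin_gaussianReal (s : ℝ) :
    ∫ z, z * Real.sin (s * z) ∂gaussianReal 0 1 = s * Real.exp (-(s ^ 2 / 2)) := by
  rw [← integral_cos_gaussianReal, ← integral_const_mul,
    integral_gaussianReal_eq_integral_smul one_ne_zero,
    integral_gaussianReal_eq_integral_smul one_ne_zero]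
  set p := gaussianPDFReal 0 1 with hp
  have hpint : Integrable p := integrable_gaussianPDFReal 0 1
  have hpe : p = fun x => (Real.sqrt (2 * Real.pi))⁻¹ * Real.exp (-(1 / 2) * x ^ 2) := by
    funext x
    rw [hp, gaussianPDFReal]
    norm_num
    left
    ring
  have hpd : ∀ x, HasDerivAt p (-(x * p x)) x := fun x => by
    rw [hpe]
    have := (((hasDerivAt_pow 2 x).const_mul (-(1 / 2) : ℝ)).exp).const_mul
      (Real.sqrt (2 * Real.pi))⁻¹
    refine this.congr_deriv ?_
    norm_num
    ring
  have hxp : Integrable fun x => x * p x := by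
    rw [hpe]
    have := (integrable_mul_exp_neg_mul_sq (b := 1 / 2) (by norm_num)).const_mul
      (Real.sqrt (2 * Real.pi))⁻¹
    refine this.congr (Filter.Eventually.of_forall fun x => ?_)
    simp only
    ring
  have hi1 : Integrable fun x => p x • (x * Real.sin (s * x)) := by
    have := hxp.bdd_mul (f := fun x => Real.sin (s * x)) (c := 1)
      (by fun_prop) (Filter.Eventually.of_forall fun x => Real.abs_sin_le_one _)
    refine this.congr (Filter.Eventually.of_forall fun x => ?_)
    simp only [smul_eq_mul]
    ring
  have hi2 : Integrable fun x => p x • (s * Real.cos (s * x)) := by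
    have := (hpint.bdd_mul (f := fun x => Real.cos (s * x)) (c := 1)
      (by fun_prop) (Filter.Eventually.of_forall fun x => Real.abs_cos_le_one _)).const_mul s
    refine this.congr (Filter.Eventually.of_forall fun x => ?_)
    simp only [smul_eq_mul]
    ring
  have hi3 : Integrable fun x => Real.sin (s * x) * p x :=
    hpint.bdd_mul (c := 1) (by fun_prop)
      (Filter.Eventually.of_forall fun x => Real.abs_sin_le_one _)
  -- The derivative of `sin (s * x) * p x` has integral zero.
  have hzero := integral_eq_zero_of_hasDerivAt_of_integrable
    (f := fun x => Real.sin (s * x) * p x)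
    (f' := fun x => p x • (s * Real.cos (s * x)) - p x • (x * Real.sin (s * x)))
    (fun x => by
      have h1 : HasDerivAt (fun x => Real.sin (s * x)) (Real.cos (s * x) * (s * 1)) x :=
        ((hasDerivAt_id x).const_mul s).sin
      refine (h1.mul (hpd x)).congr_deriv ?_
      simp only [smul_eq_mul]
      ring) (hi2.sub hi1) hi3
  rw [integral_sub hi2 hi1] at hzero
  linarith

/-- The normalised logarithm of the Metropolis ratio from `0` for the potential `-cos`. -/
def cosLogRatio (u : ℝ) : ℝ := Real.cos u - 1 + u * Real.sin u / 2

theorem abs_cosLogRatio_le (u : ℝ) : |cosLogRatio u| ≤ 2 + |u| / 2 := by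
  have h1 := Real.abs_cos_le_one u
  have h2 : |u * Real.sin u| ≤ |u| := by
    rw [abs_mul]
    exact mul_le_of_le_one_right (abs_nonneg _) (Real.abs_sin_le_one u)
  rw [abs_le] at h1 h2 ⊢
  unfold cosLogRatio
  constructor <;> linarith

/-- The exponent grows only linearly, so every exponential moment is finite. In particular the
moment generating function is differentiable at 0. -/
theorem integrable_exp_mul_cosLogRatio (s t : ℝ) :
    Integrable (fun z => Real.exp (t * cosLogRatio (s * z))) (gaussianReal 0 1) := by
  have habs : Integrable (fun z : ℝ => Real.exp (|t| * |s| / 2 * |z|)) (gaussianReal 0 1) :=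
    integrable_exp_mul_abs (integrable_exp_mul_gaussianReal _)
      (integrable_exp_mul_gaussianReal _)
  refine (habs.const_mul (Real.exp (2 * |t|))).mono'
    (by unfold cosLogRatio; fun_prop) (Filter.Eventually.of_forall fun z => ?_)
  rw [Real.norm_eq_abs, abs_of_pos (Real.exp_pos _), ← Real.exp_add]
  refine Real.exp_le_exp.2 ((le_abs_self _).trans ?_)
  rw [abs_mul]
  refine (mul_le_mul_of_nonneg_left (abs_cosLogRatio_le _) (abs_nonneg t)).trans (le_of_eq ?_)
  rw [abs_mul]
  ring

/-- The cosine contributes `exp (-1) - 1` and, by parts, the sine term another `exp (-1)`. The total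
is negative since e > 2, which is what drives rejection for intermediate steps. -/
theorem integral_cosLogRatio :
    ∫ z, cosLogRatio (Real.sqrt 2 * z) ∂gaussianReal 0 1 = 2 * Real.exp (-1) - 1 := by
  have hc : Integrable (fun z => Real.cos (Real.sqrt 2 * z)) (gaussianReal 0 1) :=
    Integrable.of_bound (by fun_prop) 1
      (Filter.Eventually.of_forall fun x => Real.abs_cos_le_one _)
  have hs : Integrable (fun z => z * Real.sin (Real.sqrt 2 * z)) (gaussianReal 0 1) :=
    (IsGaussian.integrable_id (μ := gaussianReal 0 1)).mul_bdd (c := 1) (by fun_prop)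
      (Filter.Eventually.of_forall fun x => Real.abs_sin_le_one _)
  have heq : ∀ z, cosLogRatio (Real.sqrt 2 * z) = (Real.cos (Real.sqrt 2 * z) - 1) +
      Real.sqrt 2 / 2 * (z * Real.sin (Real.sqrt 2 * z)) := fun z => by
    rw [cosLogRatio]
    ring
  simp_rw [heq]
  have hc1 : Integrable (fun z => Real.cos (Real.sqrt 2 * z) - 1) (gaussianReal 0 1) :=
    hc.sub (integrable_const 1)
  rw [integral_add hc1 (hs.const_mul _), integral_sub hc (integrable_const 1), integral_const_mul, integral_cos_gaussianReal,
    integral_mul_sin_gaussianReal]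
  have h2 : Real.sqrt 2 ^ 2 = 2 := Real.sq_sqrt (by norm_num)
  rw [h2]
  norm_num
  linear_combination (Real.exp (-1) / 2) * h2

theorem exists_integral_exp_cosLogRatio_le :
    ∃ l₀ δ : ℝ, 0 < l₀ ∧ 0 < δ ∧ ∀ l, 0 < l → l ≤ l₀ →
      ∫ z, Real.exp (l * cosLogRatio (Real.sqrt 2 * z)) ∂gaussianReal 0 1 ≤
        Real.exp (-(δ * l)) := by
  set X : ℝ → ℝ := fun z => cosLogRatio (Real.sqrt 2 * z) with hX
  have huniv : integrableExpSet X (gaussianReal 0 1) = Set.univ :=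
    Set.eq_univ_of_forall fun t => integrable_exp_mul_cosLogRatio _ _
  have hd : HasDerivAt (mgf X (gaussianReal 0 1)) (2 * Real.exp (-1) - 1) 0 := by
    have := hasDerivAt_mgf (X := X) (μ := gaussianReal 0 1) (t := 0) (by simp [huniv])
    simpa [hX, integral_cosLogRatio] using this
  -- The moment generating function has slope -2δ at 0; half of it is sacrificed to the first-order
  -- error.
  set δ : ℝ := (1 - 2 * Real.exp (-1)) / 2 with hδ
  have hδ0 : 0 < δ := by
    have h1 : Real.exp (-1) * Real.exp 1 = 1 := by
      rw [← Real.exp_add]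
      simp
    have h2 := Real.exp_one_gt_d9
    have h3 := Real.exp_pos (-1)
    rw [hδ]
    nlinarith
  have hev := (hasDerivAt_iff_isLittleO.1 hd).def hδ0
  obtain ⟨ε, hε, hball⟩ := Metric.eventually_nhds_iff.1 hev
  refine ⟨ε / 2, δ, by linarith, hδ0, fun l hl hle => ?_⟩
  have h1 := hball (y := l) (by rw [Real.dist_eq, sub_zero, abs_of_pos hl]; linarith)
  rw [sub_zero, mgf_zero, Real.norm_eq_abs, Real.norm_eq_abs, abs_of_pos hl, smul_eq_mul] at h1
  have h2 := (abs_le.1 h1).2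
  have h3 : mgf X (gaussianReal 0 1) l ≤ 1 - δ * l := by nlinarith
  have h4 := Real.add_one_le_exp (-(δ * l))
  change mgf X (gaussianReal 0 1) l ≤ _
  linarith

theorem continuous_sepPotential {d : ℕ} {φ : ℝ → ℝ} (hφ : Continuous φ) :
    Continuous (sepPotential d φ) := by
  unfold sepPotential
  fun_prop

theorem continuous_gradient_sepPotential {d : ℕ} {φ φ' : ℝ → ℝ}
    (hφ : ∀ t, HasDerivAt φ (φ' t) t) (hφ' : Continuous φ') :
    Continuous (∇ (sepPotential d φ)) := by
  rw [funext (gradient_sepPotential (d := d) hφ)]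
  fun_prop

/-! ### Targets that are slow for large steps -/

/-- Normalising `φ` by an additive constant changes neither its derivatives nor the Metropolis
ratio. The majorant `G` allows unfavourable terms of the log ratio to be dropped. -/
theorem exists_spectralGap_le {d : ℕ} (hd : 0 < d) {φ φ' φ'' G : ℝ → ℝ} {h m L a b ε : ℝ}
    (hh : 0 < h) (hc : ContDiff ℝ 2 φ)
    (hφ : ∀ t, HasDerivAt φ (φ' t) t) (hφ' : ∀ t, HasDerivAt φ' (φ'' t) t)
    (hm : ∀ t, m ≤ φ'' t) (hL : ∀ t, φ'' t ≤ L) (ha : 0 < a) (hb : ∀ t, a * t ^ 2 - b ≤ φ t)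
    (hφ0 : φ' 0 = 0) (hG : Integrable (fun t => Real.exp (G t)) (gaussianReal 0 1))
    (hle : ∀ t, modeLogRatio φ φ' h (Real.sqrt (2 * h) * t) ≤ G t)
    (hε : (∫ t, Real.exp (G t) ∂gaussianReal 0 1) ^ d < ε) :
    ∃ f : EuclideanSpace ℝ (Fin d) → ℝ, HessianIn m L f ∧ IsProbabilityMeasure (target f) ∧
      spectralGap (transition f h) (target f) ≤ ENNReal.ofReal (2 * ε) := by
  have hφc : Continuous φ := hc.continuous
  have hφ'c : Continuous φ' := continuous_iff_continuousAt.2 fun t => (hφ' t).continuousAt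
  obtain ⟨c, hprob⟩ := exists_add_const_isProbabilityMeasure hφc ha hb
  have hψ : ∀ t, HasDerivAt (fun t => φ t + c) (φ' t) t := fun t => (hφ t).add_const c
  have hψc : Continuous fun t => φ t + c := hφc.add continuous_const
  have htarget := isProbabilityMeasure_target_sepPotential (d := d) hψc
  have hle' : ∀ t, Real.exp (modeLogRatio (fun t => φ t + c) φ' h (Real.sqrt (2 * h) * t)) ≤
      Real.exp (G t) := fun t => by
    refine Real.exp_le_exp.2 (le_trans (le_of_eq ?_) (hle t))
    simp only [modeLogRatio]
    ring
  have hint : Integrable (fun t => Real.exp (modeLogRatio (fun t => φ t + c) φ' h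
      (Real.sqrt (2 * h) * t))) (gaussianReal 0 1) := by
    refine hG.mono' (by unfold modeLogRatio; fun_prop) (Filter.Eventually.of_forall fun t => ?_)
    rw [Real.norm_eq_abs, abs_of_pos (Real.exp_pos _)]
    exact hle' t
  have hrate : acceptRate (sepPotential d fun t => φ t + c) h 0 < ε := by
    refine (acceptRate_sepPotential_zero_le hh hψ hφ0 hint).trans_lt (lt_of_le_of_lt ?_ hε)
    exact pow_le_pow_left₀ (integral_nonneg fun _ => (Real.exp_pos _).le)
      (integral_mono hint hG hle') d
  have : Nonempty (Fin d) := ⟨⟨0, hd⟩⟩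
  exact ⟨sepPotential d fun t => φ t + c,
    hessianIn_sepPotential (hc.add contDiff_const) hψ hφ' hm hL, htarget,
    spectralGap_le_of_acceptRate_lt (continuous_sepPotential hψc)
      (continuous_gradient_sepPotential hψ hφ'c) hrate⟩

/-- For a quadratic, `y * φ' y / 2` cancels `φ y`, and only `-h * φ' y ^ 2 / 4` survives. At `y =
√(2h) t` this is `-(κ * h) ^ 2 / 2 * t ^ 2`. -/
theorem exists_quadratic_spectralGap_le {d : ℕ} (hd : 0 < d) {κ h b ε : ℝ} (hh : 0 < h)
    (hκ : 1 ≤ κ) (hb : 0 < b) (hbh : b ≤ (κ * h) ^ 2 / 2)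
    (hε : Real.sqrt (1 / (1 + 2 * b)) ^ d < ε) :
    ∃ f : EuclideanSpace ℝ (Fin d) → ℝ, HessianIn 1 κ f ∧ IsProbabilityMeasure (target f) ∧
      spectralGap (transition f h) (target f) ≤ ENNReal.ofReal (2 * ε) := by
  refine exists_spectralGap_le (φ := fun t => κ / 2 * t ^ 2) (φ' := fun t => κ * t)
    (φ'' := fun _ => κ) (a := κ / 2) (b := 0) (G := fun t => -((κ * h) ^ 2 / 2 * t ^ 2))
    hd hh (by fun_prop) (fun t => ?_) (fun t => ?_) (fun _ => hκ) (fun _ => le_rfl)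
    (by linarith) (fun t => by simp) (by simp) ?_ (fun t => ?_) ?_
  · refine ((hasDerivAt_pow 2 t).const_mul (κ / 2)).congr_deriv ?_
    norm_num
    ring
  · simpa using (hasDerivAt_id t).const_mul κ
  · refine Integrable.of_bound (by fun_prop) 1 (Filter.Eventually.of_forall fun t => ?_)
    rw [Real.norm_eq_abs, abs_of_pos (Real.exp_pos _), Real.exp_le_one_iff]
    simp only [Left.neg_nonpos_iff]
    positivity
  · have hs : Real.sqrt (2 * h) ^ 2 = 2 * h := Real.sq_sqrt (by linarith)
    simp only [modeLogRatio]
    refine le_of_eq ?_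
    linear_combination (-(h * κ ^ 2 * t ^ 2 / 4)) * hs
  · refine lt_of_le_of_lt ?_ hε
    exact pow_le_pow_left₀ (integral_nonneg fun _ => (Real.exp_pos _).le)
      (integral_exp_neg_mul_sq_gaussianReal_le hb hbh) d

/-- With length scale √h and amplitude κh/3 the cosine changes the second derivative by at most κ/3,
so around 2κ/3 it stays in [κ/3, κ]. Since proposals from 0 have scale √(2h), the argument of the
cosine becomes √2 z, free of `h`. -/
theorem exists_cos_spectralGap_le {d : ℕ} (hd : 0 < d) {κ h ε : ℝ} (hh : 0 < h) (hκ : 3 ≤ κ)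
    (hε : (∫ z, Real.exp (κ * h / 3 * cosLogRatio (Real.sqrt 2 * z)) ∂gaussianReal 0 1) ^ d < ε) :
    ∃ f : EuclideanSpace ℝ (Fin d) → ℝ, HessianIn 1 κ f ∧ IsProbabilityMeasure (target f) ∧
      spectralGap (transition f h) (target f) ≤ ENNReal.ofReal (2 * ε) := by
  set s := Real.sqrt h with hs
  have hs0 : 0 < s := Real.sqrt_pos.2 hh
  have hsh : s ^ 2 = h := Real.sq_sqrt hh.le
  have hdiv : ∀ t, HasDerivAt (fun t => t / s) (1 / s) t := fun t =>
    (hasDerivAt_id t).div_const s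
  refine exists_spectralGap_le
    (φ := fun t => κ / 3 * t ^ 2 - κ * h / 3 * Real.cos (t / s))
    (φ' := fun t => 2 * κ / 3 * t + κ * s / 3 * Real.sin (t / s))
    (φ'' := fun t => 2 * κ / 3 + κ / 3 * Real.cos (t / s)) (a := κ / 3) (b := κ * h / 3)
    (G := fun z => κ * h / 3 * cosLogRatio (Real.sqrt 2 * z))
    hd hh (by fun_prop) (fun t => ?_) (fun t => ?_) (fun t => ?_) (fun t => ?_)
    (by linarith) (fun t => ?_) (by simp) (integrable_exp_mul_cosLogRatio _ _) (fun t => ?_) hε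
  · refine (((hasDerivAt_pow 2 t).const_mul (κ / 3)).sub
      (((hdiv t).cos).const_mul (κ * h / 3))).congr_deriv ?_
    rw [← hsh]
    field_simp
    norm_num
    ring
  · refine (((hasDerivAt_id t).const_mul (2 * κ / 3)).add
      (((hdiv t).sin).const_mul (κ * s / 3))).congr_deriv ?_
    field_simp
  · nlinarith [Real.neg_one_le_cos (t / s)]
  · nlinarith [Real.cos_le_one (t / s)]
  · nlinarith [Real.cos_le_one (t / s), mul_pos (by linarith : 0 < κ) hh]
  · have h2 : Real.sqrt (2 * h) = Real.sqrt 2 * s := Real.sqrt_mul (by norm_num) h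
    have harg : Real.sqrt (2 * h) * t / s = Real.sqrt 2 * t := by
      rw [h2]
      field_simp
    simp only [modeLogRatio, cosLogRatio, harg]
    have hsq : 0 ≤ h * (2 * κ / 3 * (Real.sqrt (2 * h) * t) +
        κ * s / 3 * Real.sin (Real.sqrt 2 * t)) ^ 2 / 4 := by positivity
    rw [zero_div, Real.cos_zero]
    -- The squared-gradient term only lowers the ratio and is discarded; the quadratic part of the
    -- rest cancels.
    refine (sub_le_self _ hsq).trans (le_of_eq ?_)
    rw [h2, ← hsh]
    ring

/-! ### The standard Gaussian target and small steps -/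

/-- The potential `t ^ 2 / 2` normalised to a probability density. -/
def gaussPotential (t : ℝ) : ℝ := t ^ 2 / 2 + Real.log (Real.sqrt (2 * Real.pi))

theorem withDensity_gaussPotential :
    ((volume : Measure ℝ).withDensity fun t => ENNReal.ofReal (Real.exp (-gaussPotential t))) =
      gaussianReal 0 1 := by
  rw [gaussianReal_of_var_ne_zero 0 one_ne_zero]
  congr 1
  funext t
  rw [gaussianPDF, gaussianPDFReal, gaussPotential, neg_add, Real.exp_add, Real.exp_neg (Real.log _),
    Real.exp_log (by positivity), mul_comm]
  norm_num
  congr 3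
  ring

theorem hasDerivAt_gaussPotential (t : ℝ) : HasDerivAt gaussPotential t t := by
  refine (((hasDerivAt_pow 2 t).div_const 2).add_const _).congr_deriv ?_
  norm_num

theorem continuous_gaussPotential : Continuous gaussPotential := by
  unfold gaussPotential
  fun_prop

theorem target_gaussPotential (d : ℕ) :
    target (sepPotential d gaussPotential) = stdGaussian (EuclideanSpace ℝ (Fin d)) := by
  have : IsProbabilityMeasure ((volume : Measure ℝ).withDensity
      fun t => ENNReal.ofReal (Real.exp (-gaussPotential t))) := by
    rw [withDensity_gaussPotential]
    infer_instance
  rw [target_sepPotential continuous_gaussPotential, withDensity_gaussPotential,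
    map_pi_eq_stdGaussian]

theorem map_apply_stdGaussian {d : ℕ} (i : Fin d) :
    (stdGaussian (EuclideanSpace ℝ (Fin d))).map (fun z => z i) = gaussianReal 0 1 := by
  rw [← map_pi_eq_stdGaussian, Measure.map_map (by fun_prop) (by fun_prop)]
  exact (measurePreserving_eval (fun _ : Fin d => gaussianReal 0 1) i).map_eq

theorem memLp_apply_stdGaussian {d : ℕ} (i : Fin d) :
    MemLp (fun z => z i) 2 (stdGaussian (EuclideanSpace ℝ (Fin d))) := by
  have h1 : MemLp id 2 ((stdGaussian (EuclideanSpace ℝ (Fin d))).map fun z => z i) := by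
    rw [map_apply_stdGaussian]
    exact memLp_id_gaussianReal 2
  exact (memLp_map_measure_iff (by fun_prop) (by fun_prop)).1 h1

theorem integral_apply_stdGaussian {d : ℕ} (i : Fin d) :
    ∫ z, z i ∂stdGaussian (EuclideanSpace ℝ (Fin d)) = 0 := by
  have h1 := integral_map (μ := stdGaussian (EuclideanSpace ℝ (Fin d))) (φ := fun z => z i)
    (f := fun t : ℝ => t) (by fun_prop) (by fun_prop)
  rw [← h1, map_apply_stdGaussian, integral_id_gaussianReal]

theorem variance_apply_stdGaussian {d : ℕ} (i : Fin d) :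
    variance (fun z => z i) (stdGaussian (EuclideanSpace ℝ (Fin d))) = 1 := by
  rw [← variance_id_map (by fun_prop), map_apply_stdGaussian, variance_id_gaussianReal]
  simp

theorem integral_apply_sq_stdGaussian {d : ℕ} (i : Fin d) :
    ∫ z, z i ^ 2 ∂stdGaussian (EuclideanSpace ℝ (Fin d)) = 1 := by
  rw [← variance_of_integral_eq_zero (by fun_prop) (integral_apply_stdGaussian i),
    variance_apply_stdGaussian]

/-- `min 1 (exp a) = exp (min 0 a)`, and the exponential is 1-Lipschitz on the nonpositive reals. -/
theorem abs_min_one_exp_sub_le (a b : ℝ) :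
    |min 1 (Real.exp a) - min 1 (Real.exp b)| ≤ |a - b| := by
  have key : ∀ u v : ℝ, u ≤ v → v ≤ 0 → Real.exp v - Real.exp u ≤ v - u := fun u v huv hv => by
    have h1 := Real.add_one_le_exp (u - v)
    have h2 : Real.exp u = Real.exp v * Real.exp (u - v) := by
      rw [← Real.exp_add]
      congr 1
      ring
    have h3 : Real.exp v ≤ 1 := Real.exp_le_one_iff.2 hv
    rw [h2]
    nlinarith [Real.exp_pos v]
  have hmin : ∀ a, min 1 (Real.exp a) = Real.exp (min 0 a) := fun a => by
    rw [Real.exp_monotone.map_min, Real.exp_zero]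
  wlog hab : b ≤ a generalizing a b
  · rw [abs_sub_comm, abs_sub_comm a]
    exact this b a (le_of_not_ge hab)
  rw [hmin, hmin, abs_of_nonneg (sub_nonneg.2 (Real.exp_le_exp.2 (min_le_min_left 0 hab))),
    abs_of_nonneg (sub_nonneg.2 hab)]
  refine (key _ _ (min_le_min_left 0 hab) (min_le_left _ _)).trans ?_
  rcases le_total 0 a with ha | ha <;> rcases le_total 0 b with hb | hb <;>
    simp only [min_eq_left, min_eq_right, ha, hb] <;> linarith

/-- The isometry of `ℝ^d` that changes the sign of the `i`-th coordinate. -/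
def flip {d : ℕ} (i : Fin d) : EuclideanSpace ℝ (Fin d) ≃ₗᵢ[ℝ] EuclideanSpace ℝ (Fin d) :=
  LinearIsometryEquiv.piLpCongrRight 2 fun j =>
    if j = i then LinearIsometryEquiv.neg ℝ else LinearIsometryEquiv.refl ℝ ℝ

theorem flip_apply {d : ℕ} (i j : Fin d) (z : EuclideanSpace ℝ (Fin d)) :
    flip i z j = if j = i then -z j else z j := by
  simp only [flip, LinearIsometryEquiv.piLpCongrRight_apply]
  split_ifs <;> simp

theorem gradient_gaussPotential {d : ℕ} (x : EuclideanSpace ℝ (Fin d)) :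
    ∇ (sepPotential d gaussPotential) x = x := by
  rw [gradient_sepPotential hasDerivAt_gaussPotential]

theorem accept_gaussPotential {d : ℕ} {h : ℝ} (hh : 0 < h) (x y : EuclideanSpace ℝ (Fin d)) :
    accept (sepPotential d gaussPotential) h x y =
      min 1 (Real.exp (h / 4 * (‖x‖ ^ 2 - ‖y‖ ^ 2))) := by
  rw [accept, ← Real.exp_sub]
  congr 2
  simp only [gradient_gaussPotential, sepPotential, gaussPotential,
    EuclideanSpace.real_norm_sq_eq, PiLp.sub_apply, PiLp.smul_apply, smul_eq_mul, Finset.sum_div,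
    Finset.mul_sum, ← Finset.sum_neg_distrib, ← Finset.sum_sub_distrib]
  refine Finset.sum_congr rfl fun i _ => ?_
  field_simp
  ring

theorem norm_sq_sub_norm_sq_flip {d : ℕ} (i : Fin d) (r s : ℝ)
    (x z : EuclideanSpace ℝ (Fin d)) :
    ‖r • x + s • z‖ ^ 2 - ‖r • x + s • flip i z‖ ^ 2 = 4 * r * s * x i * z i := by
  simp only [EuclideanSpace.real_norm_sq_eq, PiLp.add_apply, PiLp.smul_apply, smul_eq_mul,
    flip_apply, ← Finset.sum_sub_distrib]
  rw [Finset.sum_eq_single i]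
  · rw [if_pos rfl]
    ring
  · intro j _ hj
    rw [if_neg hj]
    ring
  · simp

/-- The test function is the coordinate `i`. Its expected accepted displacement has a gradient part,
at most `h * |x i|`, and a noise part, nonzero only because acceptance correlates with `z i`. That
correlation is small because the log ratio carries a factor `h`. -/
theorem spectralGap_gaussPotential_le {d : ℕ} (i : Fin d) {h : ℝ} (hh : 0 < h) :
    spectralGap (transition (sepPotential d gaussPotential) h)
        (target (sepPotential d gaussPotential)) ≤
      ENNReal.ofReal (h + h ^ 2 * |1 - h|) := by
  set f := sepPotential d gaussPotential with hfdef
  have hf : Continuous f := continuous_sepPotential continuous_gaussPotential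
  have hf' : Continuous (∇ f) :=
    continuous_gradient_sepPotential hasDerivAt_gaussPotential continuous_id
  set γ := stdGaussian (EuclideanSpace ℝ (Fin d)) with hγ
  have htarget : target f = γ := target_gaussPotential d
  have hmem : MemLp (fun z : EuclideanSpace ℝ (Fin d) => z i) 2 γ := memLp_apply_stdGaussian i
  have hz : Integrable (fun z : EuclideanSpace ℝ (Fin d) => z i) γ :=
    hmem.integrable (by norm_num)
  have hz2 : Integrable (fun z : EuclideanSpace ℝ (Fin d) => z i ^ 2) γ := hmem.integrable_sq
  set s := Real.sqrt (2 * h) with hsdef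
  have hs0 : 0 ≤ s := Real.sqrt_nonneg _
  have hs2 : s ^ 2 = 2 * h := Real.sq_sqrt (by linarith)
  have hmove : ∀ x z, move f h x z = (1 - h) • x + s • z := fun x z => by
    rw [move, gradient_gaussPotential, sub_smul, one_smul]
  have hmovei : ∀ x z, move f h x z i = (1 - h) * x i + s * z i := fun x z => by
    rw [hmove]
    simp
  -- Reflecting `z i` preserves the Gaussian law, so only the part of the acceptance odd in `z i`
  -- contributes. The Lipschitz bound controls it by a multiple of `|z i|`, and `z i ^ 2` has mean
  -- 1.
  have hstein : ∀ x, |∫ z, accept f h x (move f h x z) * z i ∂γ| ≤ h * |1 - h| * s * |x i| / 2 := by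
    intro x
    set a : EuclideanSpace ℝ (Fin d) → ℝ := fun z => accept f h x (move f h x z) with ha
    have hai : Integrable (fun z => a z * z i) γ :=
      hz.bdd_mul (c := 1) (integrable_accept_move hf hf' x).aestronglyMeasurable
        (Filter.Eventually.of_forall fun z => norm_accept_le_one _ _)
    have hflip : MeasurePreserving (flip i) γ γ :=
      ⟨(flip i).continuous.measurable, stdGaussian_map (flip i)⟩
    have hemb : MeasurableEmbedding (flip i) :=
      (flip i).toHomeomorph.measurableEmbedding
    have hsymm : ∫ z, a z * z i ∂γ = ∫ z, -(a (flip i z) * z i) ∂γ := by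
      rw [← hflip.integral_comp hemb]
      refine integral_congr_ae (Filter.Eventually.of_forall fun z => ?_)
      simp [flip_apply]
    have hai' : Integrable (fun z => -(a (flip i z) * z i)) γ := by
      refine ((hflip.integrable_comp_emb hemb).2 hai).congr
        (Filter.Eventually.of_forall fun z => ?_)
      simp [flip_apply]
    have htwo : 2 * ∫ z, a z * z i ∂γ = ∫ z, (a z - a (flip i z)) * z i ∂γ := by
      rw [two_mul]
      nth_rewrite 2 [hsymm]
      rw [← integral_add hai hai']
      exact integral_congr_ae (Filter.Eventually.of_forall fun z => by simp only; ring)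
    have hbound : ∀ z, ‖(a z - a (flip i z)) * z i‖ ≤ h * |1 - h| * s * |x i| * z i ^ 2 := by
      intro z
      have h1 : |a z - a (flip i z)| ≤ h * |1 - h| * s * |x i| * |z i| := by
        simp only [ha, hfdef, accept_gaussPotential hh]
        refine (abs_min_one_exp_sub_le _ _).trans (le_of_eq ?_)
        have h2 := norm_sq_sub_norm_sq_flip i (1 - h) s x z
        rw [← hfdef, hmove, hmove]
        have h3 : h / 4 * (‖x‖ ^ 2 - ‖(1 - h) • x + s • z‖ ^ 2) -
            h / 4 * (‖x‖ ^ 2 - ‖(1 - h) • x + s • flip i z‖ ^ 2) =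
            -(h * (1 - h) * s * x i * z i) := by linear_combination (-(h / 4)) * h2
        rw [h3, abs_neg, abs_mul, abs_mul, abs_mul, abs_mul, abs_of_pos hh, abs_of_nonneg hs0]
      rw [norm_mul, Real.norm_eq_abs, Real.norm_eq_abs, ← sq_abs (z i), pow_two, ← mul_assoc]
      exact mul_le_mul_of_nonneg_right h1 (abs_nonneg _)
    have hle := norm_integral_le_of_norm_le (hz2.const_mul (h * |1 - h| * s * |x i|))
      (Filter.Eventually.of_forall hbound)
    rw [integral_const_mul, integral_apply_sq_stdGaussian, ← htwo, Real.norm_eq_abs, abs_mul,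
      abs_of_pos (two_pos : (0 : ℝ) < 2)] at hle
    linarith
  have hE := dirichletForm_le (h := h) (C := h + h ^ 2 * |1 - h|) (g := fun z => z i) hf hf'
    (by fun_prop) (by rw [htarget]; exact hmem) (fun x => ?_) (fun x => ?_)
  · refine spectralGap_le (g := fun z => z i) (by rw [htarget]; exact hmem) ?_ ?_
    · rw [htarget, variance_apply_stdGaussian]
      exact one_pos
    · refine hE.trans (le_of_eq ?_)
      rw [htarget, variance_apply_stdGaussian, integral_apply_sq_stdGaussian]
  · simp only [hmovei]
    exact (integrable_const _).add (hz.const_mul s)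
  · have hi1 : Integrable (fun z => accept f h x (move f h x z)) γ :=
      integrable_accept_move hf hf' x
    have hi2 : Integrable (fun z => accept f h x (move f h x z) * z i) γ :=
      hz.bdd_mul (c := 1) hi1.aestronglyMeasurable
        (Filter.Eventually.of_forall fun z => norm_accept_le_one _ _)
    have heq : ∫ z, accept f h x (move f h x z) * (x i - move f h x z i) ∂γ =
        acceptRate f h x * (h * x i) - s * ∫ z, accept f h x (move f h x z) * z i ∂γ := by
      rw [acceptRate, ← integral_mul_const, ← integral_const_mul,
        ← integral_sub (hi1.mul_const _) (hi2.const_mul _)]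
      refine integral_congr_ae (Filter.Eventually.of_forall fun z => ?_)
      simp only [hmovei]
      ring
    rw [heq, abs_mul]
    have h1 : |acceptRate f h x * (h * x i)| ≤ h * |x i| := by
      rw [abs_mul, abs_mul, abs_of_pos hh, abs_of_nonneg (acceptRate_nonneg x)]
      exact mul_le_of_le_one_left (by positivity) (acceptRate_le_one x)
    have h2 : |s * ∫ z, accept f h x (move f h x z) * z i ∂γ| ≤ h ^ 2 * |1 - h| * |x i| := by
      rw [abs_mul, abs_of_nonneg hs0]
      refine (mul_le_mul_of_nonneg_left (hstein x) hs0).trans (le_of_eq ?_)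
      linear_combination (h * |1 - h| * |x i| / 2) * hs2
    have h3 := (abs_sub _ _).trans (add_le_add h1 h2)
    refine (mul_le_mul_of_nonneg_right h3 (abs_nonneg _)).trans (le_of_eq ?_)
    rw [← sq_abs (x i)]
    ring

/-! ### The lower bound on the relaxation time -/

theorem ofReal_le_relaxationTime {α : Type*} [MeasurableSpace α] {T : α → Measure α}
    {π : Measure α} {τ : ℝ} (hτ : 0 < τ) (h : spectralGap T π ≤ ENNReal.ofReal τ) :
    ENNReal.ofReal τ⁻¹ ≤ relaxationTime T π := by
  rw [ENNReal.ofReal_inv_of_pos hτ]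
  exact ENNReal.inv_le_inv.2 h

/-- Exponential decay beats the fifth power. -/
theorem exp_neg_mul_le {s x : ℝ} (hs : 0 < s) (hx : 0 < x) :
    Real.exp (-(s * x)) ≤ 120 / s ^ 5 * (x ^ 5)⁻¹ := by
  have h1 := Real.pow_div_factorial_le_exp (s * x) (by positivity) 5
  have h2 : ((5 : ℕ).factorial : ℝ) = 120 := by norm_num [Nat.factorial]
  rw [h2] at h1
  rw [Real.exp_neg, div_mul_eq_mul_div, ← div_eq_mul_inv, div_div, inv_le_comm₀
    (Real.exp_pos _) (by positivity), inv_div]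
  refine le_trans (le_of_eq ?_) h1
  ring

theorem exists_spectralGap_le_rate (A : ℝ) : ∃ C : ℝ, 0 < C ∧
    ∀ (d : ℕ) (κ h : ℝ), 2 ≤ d → 10 ≤ κ → κ ≤ A * (d : ℝ) ^ 4 → 0 < h →
      ∃ f : EuclideanSpace ℝ (Fin d) → ℝ, HessianIn 1 κ f ∧ IsProbabilityMeasure (target f) ∧
        spectralGap (transition f h) (target f) ≤
          ENNReal.ofReal (C * (Real.log d / (κ * d))) := by
  obtain ⟨l₀, δ, hl₀, hδ, hcos⟩ := exists_integral_exp_cosLogRatio_le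
  -- Beyond the cosine range, `κ * h > 3 * l₀`, so `(κ * h) ^ 2 / 2 ≥ b`.
  set b : ℝ := (3 * l₀) ^ 2 / 2 with hbdef
  have hb : 0 < b := by positivity
  set ρ : ℝ := Real.sqrt (1 / (1 + 2 * b)) with hρ
  have hρ0 : 0 < ρ := Real.sqrt_pos.2 (by positivity)
  have hρ1 : ρ < 1 := by
    rw [hρ, Real.sqrt_lt' one_pos, one_pow, div_lt_one (by positivity)]
    linarith
  set s : ℝ := -Real.log ρ with hs
  have hs0 : 0 < s := by
    rw [hs]
    linarith [Real.log_neg hρ0 hρ1]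
  -- With 15 = 3 · 5, the bound `h > B * τ` gives `δ * κ * h * d / 3 ≥ 5 * log d`, hence decay d⁻⁵.
  set B : ℝ := 15 / δ with hB
  have hB0 : 0 < B := by positivity
  set M : ℝ := 1 + 120 / s ^ 5 with hM
  have hM0 : 1 < M := by
    have : 0 < 120 / s ^ 5 := by positivity
    linarith
  set A' : ℝ := max A 1 with hA'
  have hA1 : 1 ≤ A' := le_max_right _ _
  refine ⟨B * (1 + B * (1 + B)) + 8 * A' * M, by positivity, fun d κ h hd hκ hκA hh => ?_⟩
  have hd2 : (2 : ℝ) ≤ d := by exact_mod_cast hd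
  have hd0 : (0 : ℝ) < d := by linarith
  have hκ0 : 0 < κ := by linarith
  have hlog : 1 / 2 < Real.log d := by
    have h1 := Real.log_two_gt_d9
    have h2 := Real.log_le_log two_pos hd2
    linarith
  have hlogd : Real.log d ≤ d := (Real.log_le_sub_one_of_pos hd0).trans (by linarith)
  set τ : ℝ := Real.log d / (κ * d) with hτ
  have hτ0 : 0 < τ := by
    have : 0 < Real.log d := by linarith
    positivity
  have hτ1 : τ ≤ 1 := by
    rw [hτ, div_le_one (by positivity)]
    nlinarith
  -- The growth condition on κ enters only here; the factor 2 comes from `log d > 1 / 2`.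
  have hpow : ((d : ℝ) ^ 5)⁻¹ ≤ 2 * A' * τ := by
    have h1 : κ ≤ A' * (d : ℝ) ^ 4 :=
      hκA.trans (mul_le_mul_of_nonneg_right (le_max_left _ _) (by positivity))
    rw [hτ, inv_le_iff_one_le_mul₀ (by positivity)]
    have h2 : 1 ≤ A' * (d : ℝ) ^ 4 / κ := by rwa [le_div_iff₀ hκ0, one_mul]
    have h3 : 2 * A' * (Real.log d / (κ * d)) * (d : ℝ) ^ 5 =
        (2 * Real.log d) * (A' * (d : ℝ) ^ 4 / κ) := by
      field_simp
    rw [h3]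
    nlinarith
  -- One factor 2 is that of the gap bound; the other doubles the decay estimate to make it a strict
  -- bound on the acceptance rate.
  have hsmall : ∀ ε, 0 < ε → ε ≤ M * ((d : ℝ) ^ 5)⁻¹ →
      2 * (2 * ε) ≤ (B * (1 + B * (1 + B)) + 8 * A' * M) * τ := fun ε hε hεd => by
    have h1 : M * ((d : ℝ) ^ 5)⁻¹ ≤ M * (2 * A' * τ) :=
      mul_le_mul_of_nonneg_left hpow (by linarith)
    have h2 : 0 ≤ B * (1 + B * (1 + B)) * τ := by positivity
    nlinarith
  by_cases hcase : h ≤ B * τ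
  · refine ⟨sepPotential d gaussPotential, hessianIn_sepPotential (φ'' := fun _ => 1) ?_
      hasDerivAt_gaussPotential hasDerivAt_id (fun _ => le_rfl) (fun _ => by linarith), ?_,
      (spectralGap_gaussPotential_le ⟨0, by omega⟩ hh).trans (ENNReal.ofReal_le_ofReal ?_)⟩
    · unfold gaussPotential
      fun_prop
    · rw [target_gaussPotential]
      infer_instance
    · have hhB : h ≤ B := hcase.trans (mul_le_of_le_one_right hB0.le hτ1)
      have habs : |1 - h| ≤ 1 + B := by
        rw [abs_le]
        constructor <;> linarith
      have h1 : h * |1 - h| ≤ B * (1 + B) := mul_le_mul hhB habs (abs_nonneg _) hB0.le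
      have h2 : h * (1 + h * |1 - h|) ≤ B * τ * (1 + B * (1 + B)) :=
        mul_le_mul hcase (by linarith) (by positivity) (by positivity)
      have h3 : 0 ≤ 8 * A' * M * τ := by positivity
      nlinarith
  · push Not at hcase
    by_cases hlam : κ * h / 3 ≤ l₀
    · have hlam0 : 0 < κ * h / 3 := by positivity
      have hdecay : (∫ z, Real.exp (κ * h / 3 * cosLogRatio (Real.sqrt 2 * z))
          ∂gaussianReal 0 1) ^ d ≤ ((d : ℝ) ^ 5)⁻¹ := by
        refine (pow_le_pow_left₀ (integral_nonneg fun _ => (Real.exp_pos _).le)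
          (hcos _ hlam0 hlam) d).trans ?_
        have h1 : ((d : ℝ) ^ 5)⁻¹ = Real.exp (-(5 * Real.log d)) := by
          rw [Real.exp_neg, mul_comm, Real.exp_mul, Real.exp_log hd0]
          norm_cast
        rw [h1, ← Real.exp_nat_mul]
        refine Real.exp_le_exp.2 ?_
        have h2 : 15 * Real.log d ≤ δ * (κ * h * d) := by
          have h3 := mul_le_mul_of_nonneg_left hcase.le
            (by positivity : (0 : ℝ) ≤ δ * (κ * d))
          have h4 : δ * (κ * d) * (B * τ) = 15 * Real.log d := by
            rw [hB, hτ]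
            field_simp
          linarith
        linarith
      obtain ⟨f, hf1, hf2, hf3⟩ := exists_cos_spectralGap_le (d := d) (by omega) hh
        (by linarith : 3 ≤ κ) (ε := 2 * ((d : ℝ) ^ 5)⁻¹) (hdecay.trans_lt (by
          have : 0 < ((d : ℝ) ^ 5)⁻¹ := by positivity
          linarith))
      refine ⟨f, hf1, hf2, hf3.trans (ENNReal.ofReal_le_ofReal ?_)⟩
      exact hsmall _ (by positivity) (le_mul_of_one_le_left (by positivity) hM0.le)
    · push Not at hlam
      have hbh : b ≤ (κ * h) ^ 2 / 2 := by
        rw [hbdef]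
        exact div_le_div_of_nonneg_right (pow_le_pow_left₀ (by positivity) (by linarith) 2)
          zero_le_two
      have hρd : ρ ^ d ≤ 120 / s ^ 5 * ((d : ℝ) ^ 5)⁻¹ := by
        refine le_trans (le_of_eq ?_) (exp_neg_mul_le hs0 hd0)
        rw [hs, neg_mul, neg_neg, Real.exp_mul, Real.exp_log hρ0, Real.rpow_natCast]
      obtain ⟨f, hf1, hf2, hf3⟩ := exists_quadratic_spectralGap_le (d := d) (by omega) hh
        (by linarith : 1 ≤ κ) hb hbh (ε := 2 * ρ ^ d) (by
          have : 0 < ρ ^ d := by positivity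
          linarith)
      refine ⟨f, hf1, hf2, hf3.trans (ENNReal.ofReal_le_ofReal (hsmall _ (by positivity) ?_))⟩
      refine hρd.trans (mul_le_mul_of_nonneg_right ?_ (by positivity))
      linarith

end MALA

end

theorem theorem2 (A : ℝ) :
    ∃ c : ℝ, 0 < c ∧
      ∀ (d : ℕ) (κ h : ℝ), 2 ≤ d → 10 ≤ κ → κ ≤ A * (d : ℝ) ^ 4 → 0 < h →
        ∃ f : EuclideanSpace ℝ (Fin d) → ℝ,
          MALA.HessianIn 1 κ f ∧
          IsProbabilityMeasure (MALA.target f) ∧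
          ENNReal.ofReal (c * (κ * (d : ℝ) / Real.log (d : ℝ))) ≤
            MALA.relaxationTime (MALA.transition f h) (MALA.target f) := by
  obtain ⟨C, hC, H⟩ := MALA.exists_spectralGap_le_rate A
  refine ⟨C⁻¹, inv_pos.2 hC, fun d κ h hd hκ hκA hh => ?_⟩
  obtain ⟨f, hf1, hf2, hf3⟩ := H d κ h hd hκ hκA hh
  refine ⟨f, hf1, hf2, ?_⟩
  have hlog : 0 < Real.log d := Real.log_pos (by exact_mod_cast hd)
  have hd0 : (0 : ℝ) < d := by exact_mod_cast (by omega : 0 < d)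
  have hκ0 : 0 < κ := by linarith
  have hτ := MALA.ofReal_le_relaxationTime (by positivity) hf3
  rwa [mul_inv, inv_div] at hτ
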